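/- Consider random access machines with a read-only input array of words and a work memory of registers $R_0, R_1, \dots$ (initially $0$) holding natural numbers. The instructions are: assigning a constant, copying, addition, truncated subtraction, indirect load and store, reading the input word at the address given by a register, jump, jump if $R_a < R_b$, and halting with an answer; each instruction costs one time step. A computation uses space at most $S$ (in bits) if there are $r, w$ with $r w \le S$ such that throughout the computation all registers other than the first $r$ are $0$ and every register holds a number less than $2^w$ (the input is not counted). A path decomposition of a directed graph $G$ is a finite family of simple directed paths of $G$ such that every arc of $G$ lies on exactly one path of the family. There is a deterministic program such that for every constant $k$ there are functions $T(n) = O(n^3)$ and $S(n) = O(\log n)$ (with implied constants depending only on $k$) for which the following holds. For every directed graph $G$ on the vertex set $\{0, \dots, n-1\}$, every path decomposition $P_1, \dots, P_k$ of $G$ into $k$ directed paths and all vertices $s, t$ of $G$, the program, given as input the numbers $n, s, t, k$ followed by the paths $P_1, \dots, P_k$ (each written as its number of vertices followed by its vertices in order), decides correctly whether there is a directed path (possibly without arcs) from $s$ to $t$ in $G$; and it does so simultaneously within $T(n)$ time steps and $S(n)$ bits of work space. -/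

import Mathlib

open Filter Asymptotics

/-! ### Directed graphs and path decompositions -/

namespace Digraph

variable {V : Type*}

/-- A simple directed path of `G`, given by its sequence of vertices: a nonempty list of pairwise
distinct vertices in which consecutive vertices are joined by arcs of `G`. -/
def IsSimpleDirectedPath (G : Digraph V) (p : List V) : Prop :=
  p ≠ [] ∧ p.Nodup ∧ p.IsChain G.Adj

/-- The arc `(u, v)` lies on the path `p`: `u` and `v` are consecutive vertices of `p`. -/
def ArcLiesOn (u v : V) (p : List V) : Prop :=
  [u, v] <:+: p

/-- A path decomposition of `G` into `k` paths: a family of `k` simple directed paths of `G` such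
that every arc of `G` lies on exactly one member of the family. (The existence of such a family
forces `G` to have no loops.) -/
structure IsPathDecomposition (G : Digraph V) {k : ℕ} (P : Fin k → List V) : Prop where
  isPath : ∀ i, G.IsSimpleDirectedPath (P i)
  existsUnique_arc : ∀ u v, G.Adj u v → ∃! i, ArcLiesOn u v (P i)

/-- There is a directed path from `s` to `t` in `G` (the path with no arcs is allowed). -/
def IsReachable (G : Digraph V) (s t : V) : Prop :=
  Relation.ReflTransGen G.Adj s t

end Digraph

/-! ### Random access machines with a read-only input -/

namespace RAM

/-- The instructions of a random access machine. The work memory consists of registers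
`R 0, R 1, R 2, …`; the input is a read-only array of words. Every instruction costs one step. -/
inductive Instr
  /-- `R d := c` -/
  | const (d c : ℕ)
  /-- `R d := R a` -/
  | move (d a : ℕ)
  /-- `R d := R a + R b` -/
  | add (d a b : ℕ)
  /-- `R d := max (R a - R b) 0` -/
  | sub (d a b : ℕ)
  /-- `R d := R (R a)` -/
  | load (d a : ℕ)
  /-- `R (R d) := R a` -/
  | store (d a : ℕ)
  /-- `R d := input (R a)` -/
  | read (d a : ℕ)
  /-- continue with instruction number `l` -/
  | jump (l : ℕ)
  /-- if `R a < R b`, continue with instruction number `l`, otherwise with the next one -/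
  | jumpLt (a b l : ℕ)
  /-- stop and give the answer `b` -/
  | halt (b : Bool)

/-- A program is a finite list of instructions, fixed in advance for all inputs. -/
abbrev Program := List Instr

/-- A configuration: the number of the current instruction and the contents of the registers. -/
structure Config where
  pc : ℕ
  mem : ℕ → ℕ

/-- The initial configuration: first instruction, all registers zero. -/
def init : Config := ⟨0, fun _ => 0⟩

/-- Write `x` into register `d` and go to the next instruction. -/
def Config.write (c : Config) (d x : ℕ) : Config :=
  ⟨c.pc + 1, Function.update c.mem d x⟩

/-- Effect of one instruction. Reading beyond the end of the input yields `0`. -/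
def exec (input : List ℕ) (c : Config) : Instr → Config
  | .const d x => c.write d x
  | .move d a => c.write d (c.mem a)
  | .add d a b => c.write d (c.mem a + c.mem b)
  | .sub d a b => c.write d (c.mem a - c.mem b)
  | .load d a => c.write d (c.mem (c.mem a))
  | .store d a => c.write (c.mem d) (c.mem a)
  | .read d a => c.write d (input.getD (c.mem a) 0)
  | .jump l => ⟨l, c.mem⟩
  | .jumpLt a b l => if c.mem a < c.mem b then ⟨l, c.mem⟩ else ⟨c.pc + 1, c.mem⟩
  | .halt _ => c

/-- One step of the machine; without a current instruction the machine is stuck. -/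
def step (prog : Program) (input : List ℕ) (c : Config) : Config :=
  match prog[c.pc]? with
  | some i => exec input c i
  | none => c

/-- The configuration after `τ` steps on the given input. -/
def run (prog : Program) (input : List ℕ) (τ : ℕ) : Config :=
  (step prog input)^[τ] init

/-- The configuration has halted with answer `b`. -/
def HaltedWith (prog : Program) (c : Config) (b : Bool) : Prop :=
  prog[c.pc]? = some (Instr.halt b)

/-- On this input, the machine halts after at most `T` steps, and it answers `true` if and only
if `A` holds. -/
def DecidesInTime (prog : Program) (input : List ℕ) (A : Prop) (T : ℕ) : Prop :=
  ∃ τ ≤ T, ∃ b : Bool, HaltedWith prog (run prog input τ) b ∧ (b = true ↔ A)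

/-- On this input, the work memory fits into `S` bits during the whole computation: for some `r`
and `w` with `r * w ≤ S`, only the first `r` registers are used (all others stay zero), and each
of them always holds a number of at most `w` bits. The read-only input is not counted. -/
def RunsInSpace (prog : Program) (input : List ℕ) (S : ℕ) : Prop :=
  ∃ r w : ℕ, r * w ≤ S ∧ ∀ τ a : ℕ,
    (run prog input τ).mem a < 2 ^ w ∧ (r ≤ a → (run prog input τ).mem a = 0)

end RAM

/-- The input given to the machine: the numbers `n`, `s`, `t`, `k`, followed by the `k` paths, each
of them written as its number of vertices followed by the vertices in order. -/
def encodeInput {n k : ℕ} (P : Fin k → List (Fin n)) (s t : Fin n) : List ℕ :=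
  [n, (s : ℕ), (t : ℕ), k] ++
    (List.ofFn P).flatMap fun p => p.length :: p.map fun v => (v : ℕ)

/-! If one vertex of a path is reachable from `s`, so are all vertices after it on that path. Hence
the reachable positions of each path form a final segment, and knowing them takes one number per
path: `k` counters of O(log n) bits and a fixed number of scratch registers. The counters `D` start
at 0 and only grow. Each vertex in a known segment, and `s` itself, is looked up in all paths; an
occurrence outside the segment of its path extends that segment (`Sound.extend`) and restarts the
search. If `t` turns up, it is reachable. If a whole scan changes nothing, every occurrence of every
found vertex lies in a segment, so the found vertices are closed under arcs and `t` is not reachable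
(`OuterInv.not_reach`). Termination and time come from one measure. With `B = base k` the length of
the input, it encodes the triple (missing positions, rest of the outer scan, rest of the inner scan)
with weights `B ^ 2`, `B`, 1. At most 25 machine steps lead from a loop head to a correct halt or to
a loop head of smaller measure (`Layout.inner_step`, `Layout.outer_step`). At most `k * n` positions
are missing and `B` is O(n) for fixed `k`, which gives O(n^3). -/

namespace RAM

/-! ### Symbolic execution with time and space bounds -/

/-- From the configuration `c`, within `N` steps, a configuration satisfying `Q` is reached, and
the memory satisfies `Good` until then. -/
def Leads (prog : Program) (input : List ℕ) (Good : (ℕ → ℕ) → Prop) (Q : Config → Prop) :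
    ℕ → Config → Prop
  | 0, c => Good c.mem ∧ Q c
  | N + 1, c => Good c.mem ∧ (Q c ∨ Leads prog input Good Q N (step prog input c))

namespace Leads

variable {prog : Program} {input : List ℕ} {Good : (ℕ → ℕ) → Prop} {Q Q' : Config → Prop}

theorem done {N : ℕ} {c : Config} (hG : Good c.mem) (hQ : Q c) : Leads prog input Good Q N c := by
  cases N
  · exact ⟨hG, hQ⟩
  · exact ⟨hG, Or.inl hQ⟩

theorem mono {N M : ℕ} {c : Config} (hNM : N ≤ M) (h : Leads prog input Good Q N c) :
    Leads prog input Good Q M c := by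
  induction N generalizing M c with
  | zero => exact done h.1 h.2
  | succ N ih =>
    obtain ⟨M, rfl⟩ : ∃ M', M = M' + 1 := ⟨M - 1, by omega⟩
    exact ⟨h.1, h.2.imp id fun h => ih (by omega) h⟩

theorem trans {N M : ℕ} {c : Config} (h : Leads prog input Good Q N c)
    (h' : ∀ c', Good c'.mem → Q c' → Leads prog input Good Q' M c') :
    Leads prog input Good Q' (N + M) c := by
  induction N generalizing c with
  | zero => exact mono (by omega) (h' c h.1 h.2)
  | succ N ih =>
    rcases h.2 with hQ | hs
    · exact mono (by omega) (h' c h.1 hQ)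
    · rw [show N + 1 + M = N + M + 1 by omega]
      exact ⟨h.1, Or.inr (ih hs)⟩

theorem exists_iterate {N : ℕ} {c : Config} (h : Leads prog input Good Q N c) :
    ∃ τ ≤ N, Q ((step prog input)^[τ] c) ∧ ∀ σ ≤ τ, Good ((step prog input)^[σ] c).mem := by
  induction N generalizing c with
  | zero =>
    refine ⟨0, le_rfl, h.2, fun σ hσ => ?_⟩
    obtain rfl : σ = 0 := by omega
    exact h.1
  | succ N ih =>
    rcases h.2 with hQ | hs
    · refine ⟨0, by omega, hQ, fun σ hσ => ?_⟩
      obtain rfl : σ = 0 := by omega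
      exact h.1
    · obtain ⟨τ, hτ, hq, hg⟩ := ih hs
      refine ⟨τ + 1, by omega, hq, fun σ hσ => ?_⟩
      cases σ with
      | zero => exact h.1
      | succ σ => exact hg σ (by omega)

end Leads

/-- Only the first `r` registers are nonzero, and all contents are below `W`. -/
def Fits (r W : ℕ) (m : ℕ → ℕ) : Prop :=
  ∀ a, m a < W ∧ (r ≤ a → m a = 0)

theorem Fits.update {r W : ℕ} {m : ℕ → ℕ} (h : Fits r W m) {d v : ℕ} (hd : d < r) (hv : v < W) :
    Fits r W (Function.update m d v) := by
  intro a
  by_cases ha : a = d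
  · subst ha
    simpa using ⟨hv, fun h => by omega⟩
  · simpa [Function.update_of_ne ha] using h a

section Instructions

variable {prog : Program} {input : List ℕ} {r W : ℕ} {Q : Config → Prop} {N pc : ℕ} {m : ℕ → ℕ}

/-- Common core of all register-writing instructions. The rest of the run is the last argument, so
straight-line code is verified by a chain of `refine`, one per instruction. -/
theorem Leads.write {i : Instr} {d v : ℕ} (hG : Fits r W m) (hi : prog[pc]? = some i)
    (he : exec input ⟨pc, m⟩ i = ⟨pc + 1, Function.update m d v⟩) (hd : d < r) (hv : v < W)
    (next : Fits r W (Function.update m d v) →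
      Leads prog input (Fits r W) Q N ⟨pc + 1, Function.update m d v⟩) :
    Leads prog input (Fits r W) Q (N + 1) ⟨pc, m⟩ := by
  refine ⟨hG, Or.inr ?_⟩
  have : step prog input ⟨pc, m⟩ = ⟨pc + 1, Function.update m d v⟩ := by
    simp [step, hi, he]
  rw [this]
  exact next (hG.update hd hv)

theorem Leads.const {d v : ℕ} (hG : Fits r W m) (hi : prog[pc]? = some (.const d v))
    (hd : d < r) (hv : v < W)
    (next : Fits r W (Function.update m d v) →
      Leads prog input (Fits r W) Q N ⟨pc + 1, Function.update m d v⟩) :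
    Leads prog input (Fits r W) Q (N + 1) ⟨pc, m⟩ :=
  Leads.write hG hi rfl hd hv next

theorem Leads.add {d a b v : ℕ} (hG : Fits r W m) (hi : prog[pc]? = some (.add d a b))
    (hd : d < r) (hmv : m a + m b = v) (hv : v < W)
    (next : Fits r W (Function.update m d v) →
      Leads prog input (Fits r W) Q N ⟨pc + 1, Function.update m d v⟩) :
    Leads prog input (Fits r W) Q (N + 1) ⟨pc, m⟩ :=
  Leads.write hG hi (by simp [exec, Config.write, hmv]) hd hv next

theorem Leads.sub {d a b v : ℕ} (hG : Fits r W m) (hi : prog[pc]? = some (.sub d a b))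
    (hd : d < r) (hmv : m a - m b = v) (hv : v < W)
    (next : Fits r W (Function.update m d v) →
      Leads prog input (Fits r W) Q N ⟨pc + 1, Function.update m d v⟩) :
    Leads prog input (Fits r W) Q (N + 1) ⟨pc, m⟩ :=
  Leads.write hG hi (by simp [exec, Config.write, hmv]) hd hv next

theorem Leads.load {d a b v : ℕ} (hG : Fits r W m) (hi : prog[pc]? = some (.load d a))
    (hd : d < r) (hab : m a = b) (hmv : m b = v)
    (next : Fits r W (Function.update m d v) →
      Leads prog input (Fits r W) Q N ⟨pc + 1, Function.update m d v⟩) :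
    Leads prog input (Fits r W) Q (N + 1) ⟨pc, m⟩ :=
  Leads.write hG hi (by simp [exec, Config.write, hab, hmv]) hd (hmv ▸ (hG b).1) next

theorem Leads.store {d a b v : ℕ} (hG : Fits r W m) (hi : prog[pc]? = some (.store d a))
    (hdb : m d = b) (hmv : m a = v) (hb : b < r)
    (next : Fits r W (Function.update m b v) →
      Leads prog input (Fits r W) Q N ⟨pc + 1, Function.update m b v⟩) :
    Leads prog input (Fits r W) Q (N + 1) ⟨pc, m⟩ :=
  Leads.write hG hi (by simp [exec, Config.write, hdb, hmv]) hb (hmv ▸ (hG a).1) next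

theorem Leads.read {d a b v : ℕ} (hG : Fits r W m) (hi : prog[pc]? = some (.read d a))
    (hd : d < r) (hab : m a = b) (hmv : input.getD b 0 = v) (hv : v < W)
    (next : Fits r W (Function.update m d v) →
      Leads prog input (Fits r W) Q N ⟨pc + 1, Function.update m d v⟩) :
    Leads prog input (Fits r W) Q (N + 1) ⟨pc, m⟩ :=
  Leads.write hG hi (by subst hab hmv; rfl) hd hv next

theorem Leads.jump {l : ℕ} (hG : Fits r W m) (hi : prog[pc]? = some (.jump l))
    (next : Leads prog input (Fits r W) Q N ⟨l, m⟩) :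
    Leads prog input (Fits r W) Q (N + 1) ⟨pc, m⟩ := by
  refine ⟨hG, Or.inr ?_⟩
  simpa [step, hi, exec] using next

theorem Leads.jumpLt {a b u v l : ℕ} (hG : Fits r W m) (hi : prog[pc]? = some (.jumpLt a b l))
    (ha : m a = u) (hb : m b = v)
    (next : u < v → Leads prog input (Fits r W) Q N ⟨l, m⟩)
    (next' : ¬ u < v → Leads prog input (Fits r W) Q N ⟨pc + 1, m⟩) :
    Leads prog input (Fits r W) Q (N + 1) ⟨pc, m⟩ := by
  refine ⟨hG, Or.inr ?_⟩
  subst ha hb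
  by_cases h : m a < m b
  · simpa [step, hi, exec, h] using next h
  · simpa [step, hi, exec, h] using next' h

end Instructions

/-- A halted configuration reached within the given time and space determines the behaviour of the
whole computation. -/
theorem decides_and_fits {prog : Program} {input : List ℕ} {A : Prop} {T r w : ℕ}
    (h : Leads prog input (Fits r (2 ^ w)) (fun c => ∃ b, HaltedWith prog c b ∧ (b = true ↔ A))
      T init) :
    DecidesInTime prog input A T ∧ RunsInSpace prog input (r * w) := by
  obtain ⟨τ, hτ, ⟨b, hb, hA⟩, hg⟩ := h.exists_iterate
  refine ⟨⟨τ, hτ, b, hb, hA⟩, r, w, le_rfl, fun σ => ?_⟩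
  rcases le_total σ τ with hσ | hσ
  · exact hg σ hσ
  · obtain ⟨δ, rfl⟩ := Nat.exists_eq_add_of_le hσ
    -- A halted configuration is a fixed point of `step`, so the space bound up to time `τ` holds at
    -- all later times.
    have hfix : step prog input ((step prog input)^[τ] init) = (step prog input)^[τ] init := by
      have hb' : prog[((step prog input)^[τ] init).pc]? = some (Instr.halt b) := hb
      simp [step, hb', exec]
    have : run prog input (τ + δ) = (step prog input)^[τ] init := by
      rw [run, add_comm, Function.iterate_add_apply]
      exact Function.iterate_fixed hfix δ
    rw [this]
    exact hg τ le_rfl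

end RAM

/-! ### The program, its invariants and its measure -/

namespace RAM

/-- The program. Register `12 + c` holds, for `1 ≤ c ≤ k`, the length of the longest final segment
of the `c`-th path all of whose vertices have been found reachable. An outer scan (registers 4, 5, 6)
runs through the positions of all paths; every reached vertex found (register 7) is looked up by an
inner scan (registers 8, 9, 10) through all positions, and whenever a final segment grows, the outer
scan is restarted. In a scan, the three registers hold the address, the number of remaining vertices
of the current path, and the register belonging to that path. -/
def reachProgram : Program :=
  [.const 1 1, .const 3 2, .read 3 3, .const 2 3, .read 2 2, .const 6 12, .add 2 2 6,
    -- 7: start the outer scan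
    .const 4 4, .const 5 0, .const 6 12, .read 7 1,
    -- 11: process the vertex in register 7
    .jumpLt 7 3 14, .jumpLt 3 7 14, .halt true,
    .const 8 4, .const 9 0, .const 10 12,
    -- 17: inner scan
    .jumpLt 0 9 23, .jumpLt 10 2 20, .jump 33,
    .read 9 8, .add 10 10 1, .jump 29,
    .read 11 8, .jumpLt 11 7 28, .jumpLt 7 11 28, .load 12 10, .jumpLt 12 9 31,
    .sub 9 9 1, .add 8 8 1, .jump 17,
    .store 10 9, .jump 7,
    -- 33: outer scan
    .jumpLt 0 5 40, .jumpLt 6 2 36, .halt false,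
    .read 5 4, .add 6 6 1, .add 4 4 1, .jump 33,
    .load 12 6, .read 7 4, .sub 5 5 1, .add 4 4 1, .jumpLt 5 12 11, .jump 33]

/-- The input consists of four words, the last three of which are `s`, `t`, `k`, followed by `k`
blocks; the `c`-th block (`1 ≤ c ≤ k`) ends before the address `base c` and consists of the number
`len c` and `len c` further words. -/
structure Layout (input : List ℕ) (k s t W : ℕ) (len base : ℕ → ℕ) : Prop where
  source : input.getD 1 0 = s
  target : input.getD 2 0 = t
  count : input.getD 3 0 = k
  len_zero : len 0 = 0
  base_zero : base 0 = 4
  base_succ : ∀ c < k, base (c + 1) = base c + len (c + 1) + 1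
  header : ∀ c < k, input.getD (base c) 0 = len (c + 1)
  input_lt : ∀ a, input.getD a 0 < W
  base_lt : base k < W
  count_lt : k + 12 < W

/-- The `r`-th word from the end of block `c`. -/
def word (input : List ℕ) (base : ℕ → ℕ) (c r : ℕ) : ℕ :=
  input.getD (base c - r) 0

/-- The words `u`, `v` are consecutive in some block. -/
def Consecutive (input : List ℕ) (k : ℕ) (len base : ℕ → ℕ) (u v : ℕ) : Prop :=
  ∃ c r, c ≤ k ∧ 1 ≤ r ∧ r + 1 ≤ len c ∧ word input base c (r + 1) = u ∧ word input base c r = v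

/-- The position `(c, r)` comes before the state `(C, R)` of a scan. -/
def Visited (C R c r : ℕ) : Prop :=
  c < C ∨ (c = C ∧ R < r)

section

variable (input : List ℕ) (k s t : ℕ) (len base : ℕ → ℕ)

/-- The final segments of the lengths `D c` consist of reachable words. -/
structure Sound (D : ℕ → ℕ) : Prop where
  le : ∀ c ≤ k, D c ≤ len c
  reach : ∀ c ≤ k, ∀ r, 1 ≤ r → r ≤ D c →
    Relation.ReflTransGen (Consecutive input k len base) s (word input base c r)

/-- The word `v` is not `t`, and all its occurrences lie in the final segments given by `D`. -/
def Settled (D : ℕ → ℕ) (v : ℕ) : Prop :=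
  v ≠ t ∧ ∀ c ≤ k, ∀ r, 1 ≤ r → r ≤ len c → word input base c r = v → r ≤ D c

/-- Positions outside the segments are passed without a look-up, so `visited` claims nothing about
them. `D` is constant during a scan, since every change restarts it. -/
structure OuterInv (D : ℕ → ℕ) (C R : ℕ) : Prop where
  hC : C ≤ k
  hR : R ≤ len C
  source : Settled input k t len base D s
  visited : ∀ c ≤ k, ∀ r, 1 ≤ r → r ≤ D c → Visited C R c r →
    Settled input k t len base D (word input base c r)

/-- `V` is the word being looked up. It is exempted from being settled until the inner scan ends;
`inner` records the part of the look-up already done. -/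
structure InnerInv (D : ℕ → ℕ) (C R V c r : ℕ) : Prop where
  hC : C ≤ k
  hR : R ≤ len C
  hc : c ≤ k
  hr : r ≤ len c
  ne : V ≠ t
  reach : Relation.ReflTransGen (Consecutive input k len base) s V
  source : s = V ∨ Settled input k t len base D s
  visited : ∀ c ≤ k, ∀ r, 1 ≤ r → r ≤ D c → Visited C R c r →
    word input base c r = V ∨ Settled input k t len base D (word input base c r)
  inner : ∀ c' ≤ k, ∀ r', 1 ≤ r' → r' ≤ len c' → Visited c r c' r' →
    word input base c' r' = V → r' ≤ D c'

/-- The registers that do not belong to a scan. -/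
structure Common (D m : ℕ → ℕ) : Prop where
  zero : m 0 = 0
  one : m 1 = 1
  last : m 2 = k + 12
  target : m 3 = t
  segment : ∀ c, 1 ≤ c → m (12 + c) = D c

/-- The total length of what is missing in the final segments. -/
def missing (D : ℕ → ℕ) : ℕ :=
  ∑ c ∈ Finset.range (k + 1), (len c - D c)

def OuterState (μ : ℕ) (cfg : Config) : Prop :=
  ∃ D C R m, cfg = ⟨33, m⟩ ∧ Common k t D m ∧ Sound input k s len base D ∧
    m 4 = base C - R ∧ m 5 = R ∧ m 6 = 12 + C ∧ OuterInv input k s t len base D C R ∧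
    μ = missing k len D * (base k * base k) + (base k - (base C - R)) * base k

/-- The final `+ 1` makes the measure drop when a finished inner scan returns to the outer loop
head. -/
def InnerState (μ : ℕ) (cfg : Config) : Prop :=
  ∃ D C R V c r m, cfg = ⟨17, m⟩ ∧ Common k t D m ∧ Sound input k s len base D ∧
    m 4 = base C - R ∧ m 5 = R ∧ m 6 = 12 + C ∧ m 7 = V ∧
    m 8 = base c - r ∧ m 9 = r ∧ m 10 = 12 + c ∧
    InnerInv input k s t len base D C R V c r ∧
    μ = missing k len D * (base k * base k) + (base k - (base C - R)) * base k +
      (base k - (base c - r)) + 1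

/-- The machine has halted with the correct answer. -/
def Answered (cfg : Config) : Prop :=
  ∃ b, HaltedWith reachProgram cfg b ∧
    (b = true ↔ Relation.ReflTransGen (Consecutive input k len base) s t)

/-- The machine has halted correctly or is at a loop head with measure below `μ`. -/
def Progress (μ : ℕ) (cfg : Config) : Prop :=
  Answered input k s t len base cfg ∨
    ∃ μ' < μ, OuterState input k s t len base μ' cfg ∨ InnerState input k s t len base μ' cfg

end

/-- Registers 4 to 12 are scratch. Register 12 is free because block 0 is the empty dummy block at
which scans start, so segment registers begin at 13. -/
theorem Common.update {k t : ℕ} {D m : ℕ → ℕ} (h : Common k t D m) {d v : ℕ} (hd : 4 ≤ d)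
    (hd' : d ≤ 12) : Common k t D (Function.update m d v) := by
  constructor
  · rw [Function.update_of_ne (by omega), h.zero]
  · rw [Function.update_of_ne (by omega), h.one]
  · rw [Function.update_of_ne (by omega), h.last]
  · rw [Function.update_of_ne (by omega), h.target]
  · intro c hc
    rw [Function.update_of_ne (by omega), h.segment c hc]

/-! ### Correctness and running time of the loops -/

section

variable {input : List ℕ} {k s t W : ℕ} {len base : ℕ → ℕ}

theorem Layout.base_mono (L : Layout input k s t W len base) {c c' : ℕ} (h : c ≤ c')
    (h' : c' ≤ k) : base c ≤ base c' := by
  induction c', h using Nat.le_induction with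
  | base => exact le_rfl
  | succ n hn ih =>
    have := L.base_succ n (by omega)
    have := ih (by omega)
    omega

/-- Ensures that the address `base c - r` is never truncated for `r ≤ len c`. -/
theorem Layout.len_add_four_le (L : Layout input k s t W len base) {c : ℕ} (h : c ≤ k) :
    len c + 4 ≤ base c := by
  cases c with
  | zero => simp [L.len_zero, L.base_zero]
  | succ c =>
    have h1 := L.base_succ c (by omega)
    have h2 := L.base_mono (Nat.zero_le c) (by omega)
    have h3 := L.base_zero
    omega

theorem Layout.lt_of_lt (L : Layout input k s t W len base) {c : ℕ} (h : c < k) :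
    base c < base k := by
  have h1 := L.base_succ c h
  have h2 := L.base_mono (Nat.succ_le_of_lt h) le_rfl
  simp only [Nat.succ_eq_add_one] at h2
  omega

/-- When the outer scan has ended, `t` is not reachable. -/
theorem OuterInv.not_reach {D : ℕ → ℕ} (hI : OuterInv input k s t len base D k 0) :
    ¬ Relation.ReflTransGen (Consecutive input k len base) s t := by
  intro h
  have key : ∀ v, Relation.ReflTransGen (Consecutive input k len base) s v →
      Settled input k t len base D v := by
    intro v hv
    induction hv with
    | refl => exact hI.source
    | tail _ hs ih =>
      obtain ⟨c, r, hc, h1, h2, rfl, rfl⟩ := hs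
      -- The predecessor is settled, so this occurrence of it lies in the segment, and with it the
      -- next position. The finished scan has visited that position.
      have := ih.2 c hc (r + 1) (by omega) h2 rfl
      refine hI.visited c hc r h1 (by omega) ?_
      unfold Visited
      omega
  exact (key t h).1 rfl

/-- At state `(k, 0)` every position has been compared with `V`, so `V` is settled and its exemption
can be dropped. -/
theorem InnerInv.outer {D : ℕ → ℕ} {C R V : ℕ}
    (hI : InnerInv input k s t len base D C R V k 0) : OuterInv input k s t len base D C R := by
  have hV : Settled input k t len base D V := by
    refine ⟨hI.ne, fun c hc r h1 h2 h3 => hI.inner c hc r h1 h2 ?_ h3⟩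
    unfold Visited
    omega
  refine ⟨hI.hC, hI.hR, ?_, fun c hc r h1 h2 h3 => ?_⟩
  · rcases hI.source with h | h
    · exact h ▸ hV
    · exact h
  · rcases hI.visited c hc r h1 h2 h3 with h | h
    · exact h ▸ hV
    · exact h

/-- Reachability is passed along the arcs of the path, from position `r` down to position 1 counted
from the end. -/
theorem Sound.extend {D : ℕ → ℕ} (h : Sound input k s len base D) {c r : ℕ} (hr : r ≤ len c)
    (hreach : Relation.ReflTransGen (Consecutive input k len base) s (word input base c r)) :
    Sound input k s len base (Function.update D c r) := by
  refine ⟨fun c' hc' => ?_, fun c' hc' r' h1 h2 => ?_⟩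
  · by_cases hcc : c' = c
    · subst hcc
      simpa using hr
    · rw [Function.update_of_ne hcc]
      exact h.le c' hc'
  · by_cases hcc : c' = c
    · subst hcc
      rw [Function.update_self] at h2
      induction h2 using Nat.decreasingInduction with
      | self => exact hreach
      | of_succ n hn ih => exact (ih (by omega)).tail ⟨c', n, hc', h1, by omega, rfl, rfl⟩
    · rw [Function.update_of_ne hcc] at h2
      exact h.reach c' hc' r' h1 h2

theorem missing_update_lt {D : ℕ → ℕ} {c r : ℕ} (hc : c ≤ k) (hr : r ≤ len c) (hD : D c < r) :
    missing k len (Function.update D c r) < missing k len D := by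
  refine Finset.sum_lt_sum (fun c' _ => ?_) ⟨c, by simp; omega, by simp; omega⟩
  by_cases hcc : c' = c
  · subst hcc
    simp
    omega
  · rw [Function.update_of_ne hcc]

/-- Processing a vertex starts an inner scan. -/
theorem Layout.process (L : Layout input k s t W len base) {D m : ℕ → ℕ} {C R V N : ℕ}
    (hm : Common k t D m) (hG : Fits (13 + k) W m) (hS : Sound input k s len base D)
    (h4 : m 4 = base C - R) (h5 : m 5 = R) (h6 : m 6 = 12 + C) (h7 : m 7 = V)
    (hC : C ≤ k) (hR : R ≤ len C)
    (reach : Relation.ReflTransGen (Consecutive input k len base) s V)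
    (source : s = V ∨ Settled input k t len base D s)
    (visited : ∀ c ≤ k, ∀ r, 1 ≤ r → r ≤ D c → Visited C R c r →
      word input base c r = V ∨ Settled input k t len base D (word input base c r))
    {μ : ℕ} (hμ : missing k len D * (base k * base k) + (base k - (base C - R)) * base k +
      (base k - 4) + 1 < μ) :
    Leads reachProgram input (Fits (13 + k) W) (Progress input k s t len base μ) (N + 5)
      ⟨11, m⟩ := by
  have hW := L.count_lt
  -- Shared by the two ways `V < t` and `t < V` of entering the inner scan.
  have hhead : V ≠ t → Leads reachProgram input (Fits (13 + k) W)
      (Progress input k s t len base μ) (N + 3) ⟨14, m⟩ := by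
    intro hne
    refine Leads.const hG rfl (by omega) (by omega) fun hG => ?_
    refine Leads.const hG rfl (by omega) (by omega) fun hG => ?_
    refine Leads.const hG rfl (by omega) (by omega) fun hG => ?_
    refine Leads.done hG (Or.inr ⟨_, hμ, Or.inr ⟨D, C, R, V, 0, 0, _, rfl, ?_, hS, ?_, ?_, ?_, ?_,
      ?_, ?_, ?_, ?_, ?_⟩⟩)
    · exact ((hm.update (by omega) (by omega)).update (by omega) (by omega)).update
        (by omega) (by omega)
    · simp [h4]
    · simp [h5]
    · simp [h6]
    · simp [h7]
    · simp [L.base_zero]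
    · simp
    · simp
    · refine ⟨hC, hR, by omega, by omega, hne, reach, source, visited, ?_⟩
      -- Nothing precedes the initial state `(0, 0)`, since block 0 is empty.
      intro c' _ r' _ hr' hv
      rcases hv with hv | ⟨rfl, _⟩
      · omega
      · have := L.len_zero
        omega
    · simp [L.base_zero]
  refine Leads.jumpLt hG rfl h7 hm.target (fun h => ?_) fun h => ?_
  · exact (hhead (by omega)).mono (by omega)
  refine Leads.jumpLt hG rfl hm.target h7 (fun h' => ?_) fun h' => ?_
  · exact hhead (by omega)
  obtain rfl : V = t := by omega
  exact Leads.done hG (Or.inl ⟨true, rfl, by simpa using reach⟩)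

/-- Starting the outer scan. -/
theorem Layout.start (L : Layout input k s t W len base) {D m : ℕ → ℕ} {N : ℕ}
    (hm : Common k t D m) (hG : Fits (13 + k) W m) (hS : Sound input k s len base D)
    {μ : ℕ} (hμ : missing k len D * (base k * base k) + base k * base k ≤ μ) :
    Leads reachProgram input (Fits (13 + k) W) (Progress input k s t len base μ) (N + 9)
      ⟨7, m⟩ := by
  have hW := L.count_lt
  refine Leads.const hG rfl (by omega) (by omega) fun hG => ?_
  refine Leads.const hG rfl (by omega) (by omega) fun hG => ?_
  refine Leads.const hG rfl (by omega) (by omega) fun hG => ?_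
  refine Leads.read (b := 1) hG rfl (by omega) (by simp [hm.one]) L.source
    (L.source ▸ L.input_lt 1) fun hG => ?_
  refine L.process (C := 0) (R := 0) (V := s) (D := D) ?_ hG hS ?_ ?_ ?_ ?_ (by omega) (by omega)
    .refl (Or.inl rfl) ?_ ?_
  · exact (((hm.update (by omega) (by omega)).update (by omega) (by omega)).update
      (by omega) (by omega)).update (by omega) (by omega)
  · simp [L.base_zero]
  · simp
  · simp
  · simp
  · intro c hc r h1 h2 hv
    rcases hv with hv | ⟨rfl, _⟩
    · omega
    · have := L.len_zero
      have := hS.le 0 hc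
      omega
  · refine lt_of_lt_of_le ?_ hμ
    have h4 : 4 ≤ base k := by
      have := L.len_add_four_le le_rfl
      omega
    -- With `b = B - 4`, the claim reduces to `b * B + b + 1 < B * B`; expanding the square makes it
    -- linear for `omega`.
    obtain ⟨b, hb⟩ := Nat.exists_eq_add_of_le h4
    rw [L.base_zero, hb]
    simp only [Nat.sub_zero, Nat.add_sub_cancel_left]
    have : (4 + b) * (4 + b) = b * (4 + b) + 4 * (4 + b) := by ring
    omega

theorem Layout.inner_step (L : Layout input k s t W len base) {μ : ℕ} {cfg : Config}
    (hG : Fits (13 + k) W cfg.mem) (h : InnerState input k s t len base μ cfg) :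
    Leads reachProgram input (Fits (13 + k) W) (Progress input k s t len base μ) 25 cfg := by
  obtain ⟨D, C, R, V, c, r, m, rfl, hm, hS, h4, h5, h6, h7, h8, h9, h10, hI, rfl⟩ := h
  have hW := L.count_lt
  have hW' := L.base_lt
  have hbc := L.len_add_four_le hI.hc
  have hck := L.base_mono hI.hc le_rfl
  have hcle := hI.hc
  have hrle := hI.hr
  refine Leads.jumpLt hG rfl hm.zero h9 (fun hr0 => ?_) fun hr0 => ?_
  · -- a position
    -- Advancing by one position, reached by three jumps with different memories. The premise is
    -- exactly what `inner` needs at the position being left.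
    have hskip : (word input base c r = V → r ≤ D c) → ∀ (N : ℕ) (m : ℕ → ℕ),
        Common k t D m → Fits (13 + k) W m → m 4 = base C - R → m 5 = R → m 6 = 12 + C → m 7 = V →
        m 8 = base c - r → m 9 = r → m 10 = 12 + c →
        Leads reachProgram input (Fits (13 + k) W) (Progress input k s t len base
          (missing k len D * (base k * base k) + (base k - (base C - R)) * base k +
      (base k - (base c - r)) + 1)) (N + 3) ⟨28, m⟩ := by
      intro hlen N m hm hG h4 h5 h6 h7 h8 h9 h10
      refine Leads.sub (v := r - 1) hG rfl (by omega) (by simp [h9, hm.one]) (by omega)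
        fun hG => ?_
      refine Leads.add (v := base c - r + 1) hG rfl (by omega) (by simp [h8, hm.one]) (by omega)
        fun hG => ?_
      refine Leads.jump hG rfl ?_
      refine Leads.done hG (Or.inr ⟨_, ?_, Or.inr ⟨D, C, R, V, c, r - 1, _, rfl, ?_, hS, ?_, ?_, ?_,
        ?_, ?_, ?_, ?_, ?_, rfl⟩⟩)
      · omega
      · exact (hm.update (by omega) (by omega)).update (by omega) (by omega)
      · simp [h4]
      · simp [h5]
      · simp [h6]
      · simp [h7]
      · simp
        omega
      · simp
      · simp [h10]
      · refine ⟨hI.hC, hI.hR, hI.hc, by omega, hI.ne, hI.reach, hI.source, hI.visited, ?_⟩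
        intro c' hc' r' h1 h2 hv hw
        by_cases hv' : Visited c r c' r'
        · exact hI.inner c' hc' r' h1 h2 hv' hw
        · unfold Visited at hv hv'
          obtain ⟨rfl, rfl⟩ : c' = c ∧ r' = r := by omega
          exact hlen hw
    refine Leads.read (v := word input base c r) hG rfl (by omega) h8 rfl (L.input_lt _)
      fun hG => ?_
    have hm' := hm.update (d := 11) (v := word input base c r) (by omega) (by omega)
    refine Leads.jumpLt (u := word input base c r) (v := V) hG rfl (by simp) (by simp [h7])
      (fun hlt => ?_) fun hlt => ?_
    · exact hskip (by omega) _ _ hm' hG (by simp [h4]) (by simp [h5]) (by simp [h6])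
        (by simp [h7]) (by simp [h8]) (by simp [h9]) (by simp [h10])
    refine Leads.jumpLt (v := word input base c r) (u := V) hG rfl (by simp [h7]) (by simp)
      (fun hlt' => ?_) fun hlt' => ?_
    · exact hskip (by omega) _ _ hm' hG (by simp [h4]) (by simp [h5]) (by simp [h6])
        (by simp [h7]) (by simp [h8]) (by simp [h9]) (by simp [h10])
    have hwV : word input base c r = V := by omega
    -- Makes `12 + c` a genuine segment register rather than the scratch register 12.
    have hc1 : 1 ≤ c := by
      rcases Nat.eq_zero_or_pos c with rfl | h
      · have := L.len_zero
        omega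
      · exact h
    refine Leads.load (b := 12 + c) (v := D c) hG rfl (by omega) (by simp [h10])
      (by rw [Function.update_of_ne (by omega), hm.segment c hc1]) fun hG => ?_
    have hm'' := hm'.update (d := 12) (v := D c) (by omega) (by omega)
    refine Leads.jumpLt (u := D c) (v := r) hG rfl (by simp) (by simp [h9])
      (fun hlt => ?_) fun hlt => ?_
    · refine Leads.store (b := 12 + c) (v := r) hG rfl (by simp [h10]) (by simp [h9]) (by omega)
        fun hG => ?_
      refine Leads.jump hG rfl ?_
      refine L.start (D := Function.update D c r) ?_ hG (hS.extend hI.hr (hwV ▸ hI.reach)) ?_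
      · constructor
        · rw [Function.update_of_ne (by omega), hm''.zero]
        · rw [Function.update_of_ne (by omega), hm''.one]
        · rw [Function.update_of_ne (by omega), hm''.last]
        · rw [Function.update_of_ne (by omega), hm''.target]
        · intro c' hc'
          by_cases hcc : c' = c
          · subst hcc
            simp
          · rw [Function.update_of_ne (by omega), Function.update_of_ne hcc, hm''.segment c' hc']
      -- One position fewer is missing, which frees `B * B`, the full budget of a restarted scan.
      · have := Nat.mul_le_mul_right (base k * base k)
          (Nat.succ_le_of_lt (missing_update_lt (k := k) hI.hc hI.hr hlt))
        rw [Nat.succ_mul] at this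
        omega
    · exact hskip (by omega) _ _ hm'' hG (by simp [h4]) (by simp [h5]) (by simp [h6])
        (by simp [h7]) (by simp [h8]) (by simp [h9]) (by simp [h10])
  obtain rfl : r = 0 := by omega
  refine Leads.jumpLt hG rfl h10 hm.last (fun hc => ?_) fun hc => ?_
  · -- a header
    have hlt := L.lt_of_lt (c := c) (by omega)
    have hbs := L.base_succ c (by omega)
    have hbk := L.base_mono (c := c + 1) (c' := k) (by omega) le_rfl
    refine Leads.read (v := len (c + 1)) hG rfl (by omega) h8 (L.header c (by omega)) (by omega)
      fun hG => ?_
    refine Leads.add (v := 12 + (c + 1)) hG rfl (by omega) (by simp [h10, hm.one, add_assoc])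
      (by omega) fun hG => ?_
    refine Leads.jump hG rfl ?_
    refine Leads.add (v := base c + 1) hG rfl (by omega) (by simp [h8, hm.one]) (by omega)
      fun hG => ?_
    refine Leads.jump hG rfl ?_
    refine Leads.done hG (Or.inr ⟨_, ?_, Or.inr ⟨D, C, R, V, c + 1, len (c + 1), _, rfl, ?_, hS, ?_,
      ?_, ?_, ?_, ?_, ?_, ?_, ?_, rfl⟩⟩)
    · omega
    · exact ((hm.update (by omega) (by omega)).update (by omega) (by omega)).update
        (by omega) (by omega)
    · simp [h4]
    · simp [h5]
    · simp [h6]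
    · simp [h7]
    · simp
      omega
    · simp
    · simp
    · refine ⟨hI.hC, hI.hR, by omega, le_rfl, hI.ne, hI.reach, hI.source, hI.visited, ?_⟩
      intro c' hc' r' h1 h2 hv hw
      refine hI.inner c' hc' r' h1 h2 ?_ hw
      unfold Visited at hv ⊢
      rcases hv with hv | ⟨rfl, hv⟩ <;> omega
  · -- the end of the scan
    obtain rfl : c = k := by omega
    refine Leads.jump hG rfl ?_
    exact Leads.done hG (Or.inr ⟨_, by omega, Or.inl ⟨D, C, R, m, rfl, hm, hS, h4, h5, h6,
      hI.outer, rfl⟩⟩)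

theorem Layout.outer_step (L : Layout input k s t W len base) {μ : ℕ} {cfg : Config}
    (hG : Fits (13 + k) W cfg.mem) (h : OuterState input k s t len base μ cfg) :
    Leads reachProgram input (Fits (13 + k) W) (Progress input k s t len base μ) 25 cfg := by
  obtain ⟨D, C, R, m, rfl, hm, hS, h4, h5, h6, hI, rfl⟩ := h
  have hW := L.count_lt
  have hW' := L.base_lt
  have hbc := L.len_add_four_le hI.hC
  have hck := L.base_mono hI.hC le_rfl
  have hcle := hI.hC
  have hrle := hI.hR
  refine Leads.jumpLt hG rfl hm.zero h5 (fun hr0 => ?_) fun hr0 => ?_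
  · have hC1 : 1 ≤ C := by
      rcases Nat.eq_zero_or_pos C with rfl | h
      · have := L.len_zero
        omega
      · exact h
    -- One outer move frees `B` units, enough for a complete inner scan.
    have hmul : (base k - (base C - R)) * base k =
        (base k - (base C - (R - 1))) * base k + base k := by
      rw [show base k - (base C - R) = base k - (base C - (R - 1)) + 1 by omega, Nat.succ_mul]
    refine Leads.load (b := 12 + C) (v := D C) hG rfl (by omega) h6 (hm.segment C hC1)
      fun hG => ?_
    refine Leads.read (v := word input base C R) hG rfl (by omega) (b := base C - R)
      (by simp [h4]) rfl (L.input_lt _) fun hG => ?_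
    refine Leads.sub (v := R - 1) hG rfl (by omega) (by simp [h5, hm.one]) (by omega)
      fun hG => ?_
    refine Leads.add (v := base C - R + 1) hG rfl (by omega) (by simp [h4, hm.one]) (by omega)
      fun hG => ?_
    have hm' := (((hm.update (d := 12) (v := D C) (by omega) (by omega)).update (d := 7)
      (v := word input base C R) (by omega) (by omega)).update (d := 5) (v := R - 1) (by omega)
      (by omega)).update (d := 4) (v := base C - R + 1) (by omega) (by omega)
    -- Register 5 is already decremented, so `R - 1 < D C` tests whether position `R` lies in the
    -- segment.
    refine Leads.jumpLt (u := R - 1) (v := D C) hG rfl (by simp) (by simp) (fun hlt => ?_)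
      fun hlt => ?_
    · refine L.process (C := C) (R := R - 1) (V := word input base C R) hm' hG hS ?_ ?_ ?_ ?_
        hI.hC (by omega) (hS.reach C hI.hC R (by omega) (by omega)) (Or.inr hI.source) ?_ ?_
      · simp
        omega
      · simp
      · simp [h6]
      · simp
      · intro c hc r h1 h2 hv
        by_cases hv' : Visited C R c r
        · exact Or.inr (hI.visited c hc r h1 h2 hv')
        · unfold Visited at hv hv'
          obtain ⟨rfl, rfl⟩ : c = C ∧ r = R := by omega
          exact Or.inl rfl
      · omega
    · refine Leads.jump hG rfl ?_
      refine Leads.done hG (Or.inr ⟨_, ?_, Or.inl ⟨D, C, R - 1, _, rfl, hm', hS, ?_, ?_, ?_,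
        ?_, rfl⟩⟩)
      · omega
      · simp
        omega
      · simp
      · simp [h6]
      · refine ⟨hI.hC, by omega, hI.source, fun c hc r h1 h2 hv => hI.visited c hc r h1 h2 ?_⟩
        unfold Visited at hv ⊢
        rcases hv with hv | ⟨rfl, hv⟩ <;> omega
  obtain rfl : R = 0 := by omega
  refine Leads.jumpLt hG rfl h6 hm.last (fun hc => ?_) fun hc => ?_
  · have hlt := L.lt_of_lt (c := C) (by omega)
    have hbs := L.base_succ C (by omega)
    have hbk := L.base_mono (c := C + 1) (c' := k) (by omega) le_rfl
    refine Leads.read (v := len (C + 1)) hG rfl (by omega) h4 (L.header C (by omega)) (by omega)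
      fun hG => ?_
    refine Leads.add (v := 12 + (C + 1)) hG rfl (by omega) (by simp [h6, hm.one, add_assoc])
      (by omega) fun hG => ?_
    refine Leads.add (v := base C + 1) hG rfl (by omega) (by simp [h4, hm.one]) (by omega)
      fun hG => ?_
    refine Leads.jump hG rfl ?_
    refine Leads.done hG (Or.inr ⟨_, ?_, Or.inl ⟨D, C + 1, len (C + 1), _, rfl, ?_, hS, ?_,
      ?_, ?_, ?_, rfl⟩⟩)
    · have hmul : (base k - (base C - 0)) * base k =
          (base k - (base (C + 1) - len (C + 1))) * base k + base k := by
        rw [show base k - (base C - 0) = base k - (base (C + 1) - len (C + 1)) + 1 by omega,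
          Nat.succ_mul]
      omega
    · exact ((hm.update (by omega) (by omega)).update (by omega) (by omega)).update
        (by omega) (by omega)
    · simp
      omega
    · simp
    · simp
    · refine ⟨by omega, le_rfl, hI.source, fun c hc r h1 h2 hv => hI.visited c hc r h1 h2 ?_⟩
      have := hS.le c hc
      unfold Visited at hv ⊢
      rcases hv with hv | ⟨rfl, hv⟩ <;> omega
  · obtain rfl : C = k := by omega
    exact Leads.done hG (Or.inl ⟨false, rfl, by simpa using hI.not_reach⟩)

/-- The measure strictly decreases between loop heads, each passage costing at most 25 steps. -/
theorem Layout.leads_of_progress (L : Layout input k s t W len base) (μ : ℕ) :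
    ∀ cfg : Config, Fits (13 + k) W cfg.mem → Progress input k s t len base μ cfg →
      Leads reachProgram input (Fits (13 + k) W) (Answered input k s t len base) (25 * μ) cfg := by
  induction μ using Nat.strong_induction_on with
  | _ μ ih =>
    rintro cfg hG (h | ⟨μ', hlt, h⟩)
    · exact Leads.done hG h
    · have h25 : Leads reachProgram input (Fits (13 + k) W) (Progress input k s t len base μ') 25
          cfg := h.elim (L.outer_step hG) (L.inner_step hG)
      exact (h25.trans fun c' hG' hP => ih μ' hlt c' hG' hP).mono (by omega)

/-- The program decides reachability along the blocks. -/
theorem Layout.leads_init (L : Layout input k s t W len base) :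
    Leads reachProgram input (Fits (13 + k) W) (Answered input k s t len base)
      (16 + 25 * ((∑ c ∈ Finset.range (k + 1), len c) * (base k * base k) + base k * base k))
      init := by
  have hW := L.count_lt
  have hk : k < W := by omega
  have ht : t < W := L.target ▸ L.input_lt 2
  have hG : Fits (13 + k) W fun _ => 0 := fun a => ⟨by dsimp only; omega, fun _ => rfl⟩
  refine Leads.trans (Q := Progress input k s t len base
    ((∑ c ∈ Finset.range (k + 1), len c) * (base k * base k) + base k * base k)) ?_
    fun c' hG' hP => L.leads_of_progress _ c' hG' hP
  refine Leads.const hG rfl (by omega) (by omega) fun hG => ?_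
  refine Leads.const hG rfl (by omega) (by omega) fun hG => ?_
  refine Leads.read (b := 2) (v := t) hG rfl (by omega) (by simp) L.target ht fun hG => ?_
  refine Leads.const hG rfl (by omega) (by omega) fun hG => ?_
  refine Leads.read (b := 3) (v := k) hG rfl (by omega) (by simp) L.count hk fun hG => ?_
  refine Leads.const hG rfl (by omega) (by omega) fun hG => ?_
  refine Leads.add (v := k + 12) hG rfl (by omega) (by simp) (by omega) fun hG => ?_
  -- Initially all segments are empty and the whole total length is missing. The 16 steps are 7 for
  -- the initialisation and 9 for `start`.
  refine L.start (N := 0) (D := fun _ => 0) ⟨by simp, by simp, by simp, by simp, fun c hc => ?_⟩ hG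
    ⟨fun c _ => Nat.zero_le _, fun c _ r h1 h2 => by omega⟩ (by simp [missing])
  repeat rw [Function.update_of_ne (by omega)]

end

end RAM

/-! ### The encoded paths as blocks of the input -/

namespace RAM

/-- The lists of `L`, each preceded by its length. -/
def blocks (L : List (List ℕ)) : List ℕ :=
  L.flatMap fun p => p.length :: p

/-- The length of the `c`-th list of `L`, counted from `1`. -/
def blockLen (L : List (List ℕ)) : ℕ → ℕ
  | 0 => 0
  | c + 1 => (L.getD c []).length

/-- The address at which the first `c` blocks end. -/
def blockEnd (L : List (List ℕ)) (c : ℕ) : ℕ :=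
  4 + (blocks (L.take c)).length

theorem blockEnd_succ {L : List (List ℕ)} {c : ℕ} (hc : c < L.length) :
    blockEnd L (c + 1) = blockEnd L c + blockLen L (c + 1) + 1 := by
  simp only [blockEnd, blockLen, blocks, List.take_add_one, List.getElem?_eq_getElem hc,
    Option.toList_some, List.flatMap_append, List.flatMap_singleton, List.length_append,
    List.length_cons, List.getD_eq_getElem _ _ hc]
  omega

theorem getD_blocks {L : List (List ℕ)} {c : ℕ} (hc : c < L.length) (a b d e i : ℕ)
    (hi : i ≤ (L.getD c []).length) :
    ([a, b, d, e] ++ blocks L).getD (blockEnd L c + i) 0 =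
      ((L.getD c []).length :: L.getD c []).getD i 0 := by
  have hL : blocks L = blocks (L.take c) ++ ((L.getD c []).length :: L.getD c []) ++
      blocks (L.drop (c + 1)) := by
    conv_lhs => rw [← List.take_append_drop c L, List.drop_eq_getElem_cons hc, blocks,
      List.flatMap_append, List.flatMap_cons]
    rw [List.getD_eq_getElem _ _ hc, List.append_assoc]
    rfl
  rw [hL, List.getD_append_right _ _ _ _ (by simp [blockEnd]; omega), List.append_assoc,
    List.getD_append_right _ _ _ _ (by simp [blockEnd]; omega),
    List.getD_append _ _ _ _ (by simp [blockEnd] at hi ⊢; omega)]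
  congr 1
  simp [blockEnd]
  omega

theorem layout_blocks {L : List (List ℕ)} {n s t W : ℕ} (hW : ∀ x ∈ L, ∀ v ∈ x, v < W)
    (hn : n < W) (hs : s < W) (ht : t < W) (hend : blockEnd L L.length < W)
    (hk : L.length + 12 < W) :
    Layout ([n, s, t, L.length] ++ blocks L) L.length s t W (blockLen L) (blockEnd L) where
  source := rfl
  target := rfl
  count := rfl
  len_zero := rfl
  base_zero := by simp [blockEnd, blocks]
  base_succ c hc := blockEnd_succ hc
  header c hc := by simpa [blockLen] using getD_blocks hc n s t L.length 0 (Nat.zero_le _)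
  base_lt := hend
  count_lt := hk
  input_lt a := by
    -- A header word is a list length, bounded by the end address of the whole input.
    have hlen : ∀ p ∈ L, p.length < W := by
      intro p hp
      obtain ⟨L₁, L₂, rfl⟩ := List.append_of_mem hp
      rw [blockEnd, List.take_length] at hend
      simp [blocks] at hend
      omega
    rcases lt_or_ge a ([n, s, t, L.length] ++ blocks L).length with ha | ha
    · rw [List.getD_eq_getElem _ _ ha]
      have hmem := List.getElem_mem ha
      generalize ([n, s, t, L.length] ++ blocks L)[a] = x at hmem
      simp only [List.cons_append, List.nil_append, List.mem_cons, blocks,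
        List.mem_flatMap] at hmem
      rcases hmem with rfl | rfl | rfl | rfl | ⟨p, hp, rfl | hx⟩
      · exact hn
      · exact hs
      · exact ht
      · omega
      · exact hlen p hp
      · exact hW p hp x hx
    · rw [List.getD_eq_default _ _ ha]
      omega

theorem word_blocks {L : List (List ℕ)} {c : ℕ} (hc : c < L.length) (a b d e : ℕ) {r : ℕ}
    (h1 : 1 ≤ r) (h2 : r ≤ blockLen L (c + 1)) :
    word ([a, b, d, e] ++ blocks L) (blockEnd L) (c + 1) r =
      (L.getD c []).getD ((L.getD c []).length - r) 0 := by
  have h2' : r ≤ (L.getD c []).length := h2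
  have : blockEnd L (c + 1) - r = blockEnd L c + ((L.getD c []).length - r + 1) := by
    have := blockEnd_succ hc
    rw [show blockLen L (c + 1) = (L.getD c []).length from rfl] at this
    omega
  rw [word, this, getD_blocks hc _ _ _ _ _ (by omega), List.getD_cons_succ]

/-- Index `j` from the front of a list is position `length - j` from its end; the empty block 0
contributes no pairs. -/
theorem consecutive_blocks_iff {L : List (List ℕ)} {a b d e u v : ℕ} :
    Consecutive ([a, b, d, e] ++ blocks L) L.length (blockLen L) (blockEnd L) u v ↔
      ∃ p ∈ L, [u, v] <:+: p := by
  constructor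
  · rintro ⟨c, r, hc, h1, h2, rfl, rfl⟩
    cases c with
    | zero => simp [blockLen] at h2
    | succ c =>
      rw [word_blocks (by omega) _ _ _ _ (by omega) h2,
        word_blocks (by omega) _ _ _ _ h1 (by omega)]
      have hcL : c < L.length := by omega
      simp only [blockLen, List.getD_eq_getElem _ _ hcL] at h2 ⊢
      refine ⟨L[c], List.getElem_mem _, ?_⟩
      rw [List.infix_iff_getElem?]
      refine ⟨L[c].length - (r + 1), by simp; omega, fun i hi => ?_⟩
      rw [List.getD_eq_getElem _ _ (by omega), List.getD_eq_getElem _ _ (by omega)]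
      simp only [List.length_cons, List.length_nil] at hi
      rcases i with _ | _ | i
      · simp
      · simp [show 1 + (L[c].length - (r + 1)) = L[c].length - r by omega]
      · omega
  · rintro ⟨p, hp, hpi⟩
    obtain ⟨c, hc, rfl⟩ := List.getElem_of_mem hp
    rw [List.infix_iff_getElem?] at hpi
    obtain ⟨j, hj, hij⟩ := hpi
    have hu := hij 0 (by simp)
    have hv := hij 1 (by simp)
    simp only [List.length_cons, List.length_nil] at hj
    have hlen : blockLen L (c + 1) = L[c].length := by simp [blockLen, hc]
    refine ⟨c + 1, L[c].length - (j + 1), hc, by omega, by omega, ?_, ?_⟩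
    · rw [word_blocks hc _ _ _ _ (by omega) (by omega), List.getD_eq_getElem _ _ hc,
        show L[c].length - (L[c].length - (j + 1) + 1) = j by omega, List.getD_eq_getElem?_getD]
      simp at hu
      simp [hu]
    · rw [word_blocks hc _ _ _ _ (by omega) (by omega), List.getD_eq_getElem _ _ hc,
        show L[c].length - (L[c].length - (j + 1)) = 1 + j by omega, List.getD_eq_getElem?_getD]
      simp only [List.getElem_cons_succ, List.getElem_cons_zero] at hv
      simp [hv]

theorem blockEnd_le {L : List (List ℕ)} {n : ℕ} (h : ∀ p ∈ L, p.length ≤ n) {c : ℕ}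
    (hc : c ≤ L.length) : blockEnd L c ≤ 4 + c * (n + 1) := by
  induction c with
  | zero => simp [blockEnd, blocks]
  | succ c ih =>
    have h1 := ih (by omega)
    have h2 := blockEnd_succ (L := L) (c := c) (by omega)
    have h3 : blockLen L (c + 1) ≤ n := by
      simpa [blockLen, show c < L.length by omega] using h _ (List.getElem_mem (by omega))
    rw [Nat.succ_mul]
    omega

theorem sum_blockLen_le {L : List (List ℕ)} {n : ℕ} (h : ∀ p ∈ L, p.length ≤ n) :
    ∑ c ∈ Finset.range (L.length + 1), blockLen L c ≤ L.length * n := by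
  rw [Finset.sum_range_succ', show blockLen L 0 = 0 from rfl, add_zero]
  refine (Finset.sum_le_card_nsmul _ _ n fun c hc => ?_).trans (by simp)
  rw [Finset.mem_range] at hc
  simpa [blockLen, hc] using h _ (List.getElem_mem hc)

end RAM

/-! ### From words back to vertices and arcs -/

namespace Digraph

/-- The paths of a family as lists of numbers. -/
def pathLists {n k : ℕ} (P : Fin k → List (Fin n)) : List (List ℕ) :=
  (List.ofFn P).map (List.map Fin.val)

theorem length_pathLists {n k : ℕ} (P : Fin k → List (Fin n)) : (pathLists P).length = k := by
  simp [pathLists]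

theorem encodeInput_eq {n k : ℕ} (P : Fin k → List (Fin n)) (s t : Fin n) :
    encodeInput P s t =
      [n, (s : ℕ), (t : ℕ), (pathLists P).length] ++ RAM.blocks (pathLists P) := by
  have h : ∀ p : List (Fin n), List.flatMap (fun a : Fin n => [(a : ℕ)]) p = p.map Fin.val := fun p => by
    induction p with
    | nil => rfl
    | cons a p ih => simp [List.flatMap_cons, ih]
  simp [encodeInput, RAM.blocks, pathLists, h, List.flatMap_def, List.map_ofFn, Function.comp_def]

theorem mem_pathLists {n k : ℕ} {P : Fin k → List (Fin n)} {p : List ℕ} :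
    p ∈ pathLists P ↔ ∃ i, (P i).map Fin.val = p := by
  simp [pathLists, List.mem_ofFn]

theorem IsPathDecomposition.adj_iff {n k : ℕ} {G : Digraph (Fin n)} {P : Fin k → List (Fin n)}
    (hP : G.IsPathDecomposition P) {u v : Fin n} : G.Adj u v ↔ ∃ i, [u, v] <:+: P i := by
  constructor
  · intro h
    obtain ⟨i, hi, _⟩ := hP.existsUnique_arc u v h
    exact ⟨i, hi⟩
  · rintro ⟨i, hi⟩
    simpa using (hP.isPath i).2.2.infix hi

theorem IsPathDecomposition.infix_pathLists_iff {n k : ℕ} {G : Digraph (Fin n)}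
    {P : Fin k → List (Fin n)} (hP : G.IsPathDecomposition P) {a b : ℕ} :
    (∃ p ∈ pathLists P, [a, b] <:+: p) ↔
      ∃ u v : Fin n, (u : ℕ) = a ∧ (v : ℕ) = b ∧ G.Adj u v := by
  simp only [hP.adj_iff, mem_pathLists]
  constructor
  · rintro ⟨_, ⟨i, rfl⟩, h⟩
    obtain ⟨l, hl, hab⟩ := List.infix_map_iff.1 h
    match l, hab with
    | [u, v], hab =>
      simp only [List.map_cons, List.map_nil, List.cons.injEq, and_true] at hab
      exact ⟨u, v, hab.1.symm, hab.2.symm, i, hl⟩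
  · rintro ⟨u, v, rfl, rfl, i, h⟩
    exact ⟨_, ⟨i, rfl⟩, h.map Fin.val⟩

/-- Each step of `R` joins values of vertices, so an `R`-walk from `s` never leaves the range of
`Fin.val` and lifts to `G`. -/
theorem isReachable_iff_of_val {n : ℕ} {G : Digraph (Fin n)} {R : ℕ → ℕ → Prop}
    (hR : ∀ a b, R a b ↔ ∃ u v : Fin n, (u : ℕ) = a ∧ (v : ℕ) = b ∧ G.Adj u v) {s t : Fin n} :
    Relation.ReflTransGen R s t ↔ G.IsReachable s t := by
  constructor
  · intro h
    have key : ∀ b, Relation.ReflTransGen R s b → ∃ v : Fin n, (v : ℕ) = b ∧ G.IsReachable s v := by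
      intro b hb
      induction hb with
      | refl => exact ⟨s, rfl, .refl⟩
      | tail _ hs ih =>
        obtain ⟨v, rfl, hv⟩ := ih
        obtain ⟨u, w, huv, rfl, hadj⟩ := (hR _ _).1 hs
        obtain rfl := Fin.ext huv
        exact ⟨w, rfl, hv.tail hadj⟩
    obtain ⟨v, hvt, hv⟩ := key t h
    exact Fin.ext hvt ▸ hv
  · intro h
    exact Relation.ReflTransGen.lift Fin.val
      (fun u v huv => (hR _ _).2 ⟨u, v, rfl, rfl, huv⟩) _ _ h

end Digraph

/-! ### Asymptotic bounds and conclusion -/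

/-- The number of steps that suffice for `k` paths on `n` vertices. -/
def timeBound (k n : ℕ) : ℕ :=
  16 + 25 * (k * n * ((4 + k * (n + 1)) * (4 + k * (n + 1))) +
    (4 + k * (n + 1)) * (4 + k * (n + 1)))

/-- The word length that suffices for `k` paths on `n` vertices. -/
def wordLength (k n : ℕ) : ℕ :=
  Nat.log 2 (13 + n + k + k * (n + 1)) + 1

theorem timeBound_isBigO (k : ℕ) :
    (fun n : ℕ => (timeBound k n : ℝ)) =O[atTop] (fun n : ℕ => (n : ℝ) ^ 3) := by
  refine IsBigO.of_bound (16 + 25 * (k * (4 + 2 * k) ^ 2 + (4 + 2 * k) ^ 2)) ?_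
  filter_upwards [eventually_ge_atTop 1] with n hn
  rw [Real.norm_of_nonneg (by positivity), Real.norm_of_nonneg (by positivity)]
  have hb : 4 + k * (n + 1) ≤ (4 + 2 * k) * n := by nlinarith
  have hb2 : (4 + k * (n + 1)) * (4 + k * (n + 1)) ≤ (4 + 2 * k) ^ 2 * n ^ 2 := by
    calc _ ≤ ((4 + 2 * k) * n) * ((4 + 2 * k) * n) := Nat.mul_le_mul hb hb
      _ = _ := by ring
  have hn3 : n ^ 2 ≤ n ^ 3 := Nat.pow_le_pow_right hn (by omega)
  have hn1 : 1 ≤ n ^ 3 := Nat.one_le_pow _ _ hn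
  have key : timeBound k n ≤ (16 + 25 * (k * (4 + 2 * k) ^ 2 + (4 + 2 * k) ^ 2)) * n ^ 3 := by
    calc timeBound k n ≤ 16 * n ^ 3 + 25 * (k * n * ((4 + 2 * k) ^ 2 * n ^ 2) +
          (4 + 2 * k) ^ 2 * n ^ 3) := by
            have h1 := hb2.trans (Nat.mul_le_mul_left _ hn3)
            have h2 := Nat.mul_le_mul_left (k * n) hb2
            unfold timeBound
            omega
      _ = _ := by ring
  exact_mod_cast key

theorem wordLength_isBigO (k : ℕ) :
    (fun n : ℕ => (((13 + k) * wordLength k n : ℕ) : ℝ)) =O[atTop]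
      (fun n : ℕ => Real.log (n : ℝ)) := by
  have hbase : (fun n : ℕ => (wordLength k n : ℝ)) =O[atTop] (fun n : ℕ => Real.log (n : ℝ)) := by
    refine IsBigO.of_bound (Nat.log 2 (14 + 3 * k) / Real.log 2 + 3 / Real.log 2) ?_
    -- From `n = 2` on, `log n / log 2 ≥ 1` absorbs the additive constants.
    filter_upwards [eventually_ge_atTop 2] with n hn
    have hl2 : 0 < Real.log 2 := Real.log_pos (by norm_num)
    have hln : Real.log 2 ≤ Real.log n := Real.log_le_log (by norm_num) (by exact_mod_cast hn)
    rw [Real.norm_of_nonneg (by positivity), Real.norm_of_nonneg (by linarith)]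
    have h1 : 13 + n + k + k * (n + 1) < 2 ^ (Nat.log 2 (14 + 3 * k) + 1 + (Nat.log 2 n + 1)) := by
      calc 13 + n + k + k * (n + 1) ≤ (14 + 3 * k) * n := by nlinarith
        _ < _ := by
          rw [pow_add]
          exact Nat.mul_lt_mul'' (Nat.lt_pow_succ_log_self (by omega) _)
            (Nat.lt_pow_succ_log_self (by omega) _)
    have h2 : wordLength k n ≤ Nat.log 2 (14 + 3 * k) + Nat.log 2 n + 2 := by
      have := Nat.log_lt_of_lt_pow (by omega) h1
      unfold wordLength
      omega
    have h3 : (Nat.log 2 n : ℝ) ≤ Real.log n / Real.log 2 := by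
      rw [le_div_iff₀ hl2, ← Real.log_pow]
      exact Real.log_le_log (by positivity) (by exact_mod_cast Nat.pow_log_le_self 2 (by omega))
    have h4 : (1 : ℝ) ≤ Real.log n / Real.log 2 := by rwa [le_div_iff₀ hl2, one_mul]
    have h2' : (wordLength k n : ℝ) ≤ Nat.log 2 (14 + 3 * k) + Nat.log 2 n + 2 := by
      exact_mod_cast h2
    have h5 := mul_le_mul_of_nonneg_left h4 (Nat.cast_nonneg (α := ℝ) (Nat.log 2 (14 + 3 * k)))
    calc (wordLength k n : ℝ) ≤ Nat.log 2 (14 + 3 * k) * (Real.log n / Real.log 2) +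
          3 * (Real.log n / Real.log 2) := by linarith
      _ = _ := by ring
  simpa using hbase.const_mul_left ((13 + k : ℕ) : ℝ)

theorem mainTheorem2 :
    ∃ prog : RAM.Program, ∀ k : ℕ, ∃ T S : ℕ → ℕ,
      (fun n : ℕ => (T n : ℝ)) =O[atTop] (fun n : ℕ => (n : ℝ) ^ 3) ∧
      (fun n : ℕ => (S n : ℝ)) =O[atTop] (fun n : ℕ => Real.log (n : ℝ)) ∧
      ∀ (n : ℕ) (G : Digraph (Fin n)) (P : Fin k → List (Fin n)), G.IsPathDecomposition P →
        ∀ s t : Fin n,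
          RAM.DecidesInTime prog (encodeInput P s t) (G.IsReachable s t) (T n) ∧
          RAM.RunsInSpace prog (encodeInput P s t) (S n) := by
  refine ⟨RAM.reachProgram, fun k => ⟨timeBound k, fun n => (13 + k) * wordLength k n,
    timeBound_isBigO k, wordLength_isBigO k, fun n G P hP s t => ?_⟩⟩
  -- Simple paths repeat no vertex, so they have at most `n` vertices.
  have hlen : ∀ p ∈ Digraph.pathLists P, p.length ≤ n := by
    intro p hp
    obtain ⟨i, rfl⟩ := Digraph.mem_pathLists.1 hp
    simpa using (hP.isPath i).2.1.length_le_card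
  have hk := Digraph.length_pathLists P
  have hend := RAM.blockEnd_le hlen le_rfl
  have hsum := RAM.sum_blockLen_le hlen
  -- This one sum dominates everything a register may hold: vertices, `n`, `k + 12` and the end
  -- address, at most `4 + k * (n + 1)`.
  have hw : 13 + n + k + k * (n + 1) < 2 ^ wordLength k n :=
    Nat.lt_pow_succ_log_self (by omega) _
  have hs := s.isLt
  have ht := t.isLt
  have L := RAM.layout_blocks (L := Digraph.pathLists P) (n := n) (s := s) (t := t)
    (W := 2 ^ wordLength k n) (fun x hx v hv => by
      obtain ⟨i, rfl⟩ := Digraph.mem_pathLists.1 hx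
      obtain ⟨u, _, rfl⟩ := List.mem_map.1 hv
      have := u.isLt
      omega) (by omega) (by omega) (by omega) (by rw [hk] at hend ⊢; omega) (by omega)
  have h := L.leads_init
  rw [← Digraph.encodeInput_eq] at h
  have hA := Digraph.isReachable_iff_of_val (G := G) (s := s) (t := t)
    (fun a b => (RAM.consecutive_blocks_iff (a := n) (b := s) (d := t)
      (e := (Digraph.pathLists P).length)).trans hP.infix_pathLists_iff)
  rw [← Digraph.encodeInput_eq] at hA
  unfold RAM.Answered at h
  simp only [hA] at h
  rw [hk] at h hend hsum
  refine RAM.decides_and_fits (h.mono ?_)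
  unfold timeBound
  gcongr
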